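/- For an integer $n\ge 1$ and a function $u:\mathbb R\to\mathbb R$ put $$H_1(u)=\int_{\mathbb R}(u^2+u_x^2)\,dx,\qquad H_2(u)=\int_{\mathbb R}\Big(u^{2n+1}+\sum_{k=1}^{n}\frac{(-1)^{k+1}}{2k-1}\binom nk u^{2n-2k+1}u_x^{2k}\Big)dx .$$ For $a>0$ let $\varphi_c(x)=a e^{-|x|}$ be the peakon profile of amplitude $a$, with speed $$c=\Big(1+\frac1{2n}\Big)\sum_{k=0}^{n}\frac{(-1)^k}{2k+1}\binom nk\,a^{2n-1}.$$ **Proposition 1.5.** Let $s>\frac52$ and let $G=G(n,c,r)>0$ be a given function. There is a function $\widetilde G=\widetilde G(n,c,r)>0$ such that for every integer $n\ge1$, every $\gamma>2\sqrt2$ and every $C_0>0$ there is a constant $C>0$ with the following property. Let $a>0$, let $c$ be the corresponding speed, and let $u\in H^s(\mathbb R)$ (identified with its continuous representative) satisfy $u>0$ and $m:=u-u_{xx}\ge 0$ on $\mathbb R$. If $\varepsilon>0$ and $$|H_1(u)-H_1(\varphi_c)|\le a\gamma\varepsilon,\qquad |H_2(u)-H_2(\varphi_c)|\le C_0\,G(n,c,\|u\|_{H^s})\,\varepsilon,$$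 then $u$ attains its maximum $M=\max_{x\in\mathbb R}u(x)$, and $$|M-a|\le C\sqrt{\widetilde G(n,c,\|u\|_{H^s})\,\varepsilon}.$$ -/

import Mathlib

open MeasureTheory FourierTransform
open scoped SchwartzMap

noncomputable section

namespace GeneralizedCH

open scoped Classical in
/-- The class in `L²(ℝ; ℂ)` of a real function `u`. It is only used for square integrable `u`
(it is `0` otherwise). -/
def toL2 (u : ℝ → ℝ) : Lp ℂ 2 (volume : Measure ℝ) :=
  if h : MemLp (fun x ↦ (u x : ℂ)) 2 volume then h.toLp _ else 0

/-- `u ∈ H^s(ℝ)` for a real function `u` (and `s ≥ 0`): `u` is square integrable and the tempered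
distribution that it defines belongs to the Sobolev space of order `s` over `L²`. -/
def MemHs (s : ℝ) (u : ℝ → ℝ) : Prop :=
  MemLp (fun x ↦ (u x : ℂ)) 2 volume ∧
    TemperedDistribution.MemSobolev s 2 (toL2 u : 𝓢'(ℝ, ℂ))

/-- The norm `‖u‖_{H^s} = ‖(1 - ∂ₓ²)^{s/2} u‖_{L²}`, as a weighted `L²` norm of the
Fourier–Plancherel transform. With the kernel `e^{-2πixξ}`, the symbol of `-∂ₓ²` is `(2πξ)²`. -/
def hsNorm (s : ℝ) (u : ℝ → ℝ) : ℝ :=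
  √(∫ ξ : ℝ, (1 + (2 * Real.pi * ξ) ^ 2) ^ s * ‖(𝓕 (toL2 u) : Lp ℂ 2 (volume : Measure ℝ)) ξ‖ ^ 2)

/-- The momentum density `m = u - u_xx`. -/
def momentum (u : ℝ → ℝ) (x : ℝ) : ℝ := u x - deriv (deriv u) x

/-- `H₁(u) = ∫ (u² + u_x²) dx`. -/
def H1 (u : ℝ → ℝ) : ℝ := ∫ x : ℝ, (u x ^ 2 + deriv u x ^ 2)

/-- `H₂(u) = ∫ (u^{2n+1} + ∑_{k=1}^n (-1)^{k+1}/(2k-1) C(n,k) u^{2n-2k+1} u_x^{2k}) dx`. -/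
def H2 (n : ℕ) (u : ℝ → ℝ) : ℝ :=
  ∫ x : ℝ, (u x ^ (2 * n + 1) +
    ∑ k ∈ Finset.Icc 1 n, (-1 : ℝ) ^ (k + 1) / (2 * (k : ℝ) - 1) * (n.choose k : ℝ) *
      u x ^ (2 * (n - k) + 1) * deriv u x ^ (2 * k))

/-- The peakon profile `φ_c(x) = a e^{-|x|}` of amplitude `a`. It is differentiable off `0`, so
that `deriv` is its weak derivative almost everywhere. -/
def peakon (a : ℝ) (x : ℝ) : ℝ := a * Real.exp (-|x|)

/-- The speed `c = (1 + 1/(2n)) ∑_{k=0}^n (-1)^k/(2k+1) C(n,k) a^{2n-1}` of the peakon of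
amplitude `a`. -/
def peakonSpeed (n : ℕ) (a : ℝ) : ℝ :=
  (1 + 1 / (2 * (n : ℝ))) *
    (∑ k ∈ Finset.range (n + 1), (-1 : ℝ) ^ k / (2 * (k : ℝ) + 1) * (n.choose k : ℝ)) *
    a ^ (2 * n - 1)

end GeneralizedCH

end

/-! Write `M` for the maximum of `u` and `S = density n 1 1`. Since `s > 5/2`, `u` is twice
differentiable and vanishes at infinity with `u_x`. As `m ≥ 0`, `e^x (u - u_x)` increases from `0`
and `e^{-x} (u + u_x)` decreases to `0`, so `|u_x| ≤ u`.

On that cone the density of `H₂` is at most `(S/2) u^{2n-1} (u² + u_x²)`, with equality when `|u_x|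
= u`, as for peakons (`two_mul_density_le`). Splitting off `(u ∓ u_x)²`, bounding its weight
`u^{2n-1}` by `M^{2n-1}` and integrating on each side of the maximum gives `H2_le`, an upper bound
for `H₂` in terms of `H₁` and `M`.

At the values of `H₁` and `H₂` on the peakon, this bound becomes a polynomial inequality in `M` with
a double zero at `M = a`, so `(M - a)²` is controlled linearly by the two errors (`sub_sq_le`). For
`ε ≤ a`, the bound `2M² ≤ H₁` keeps `M / a` bounded; for `ε ≥ a`, it suffices by itself. The
resulting modulus `a + G / a^{2n-1}` is a function of `c` because the speed determines `a`. -/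

namespace GeneralizedCH

open Filter Topology
open scoped ContDiff ENNReal

/-! ### Sobolev regularity via the Fourier transform -/

/-- A bounded multiple of an integrable decay weight, times an `L²` function, is integrable. -/
theorem integrable_pow_mul_rpow_mul {s : ℝ} (hs : 5 / 2 < s) (k : ℕ) (hk : k ≤ 2)
    (W : Lp ℂ 2 (volume : Measure ℝ)) :
    Integrable (fun x : ℝ ↦ ((x ^ k : ℝ) : ℂ) * ((((1 + ‖x‖ ^ 2) ^ (-s / 2) : ℝ) : ℂ) * W x)) := by
  have hcont : Continuous fun x : ℝ ↦ x ^ k * (1 + ‖x‖ ^ 2) ^ (-s / 2) := by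
    refine (by fun_prop : Continuous fun x : ℝ ↦ x ^ k).mul ?_
    exact Continuous.rpow_const (by fun_prop) fun x ↦ Or.inl (by positivity)
  have hm : MemLp (fun x : ℝ ↦ x ^ k * (1 + ‖x‖ ^ 2) ^ (-s / 2)) 2 := by
    rw [memLp_two_iff_integrable_sq hcont.aestronglyMeasurable]
    -- The squared weight is at most `(1 + x²)^{2-s}`, integrable because `2(s - 2) > 1`; this is
    -- where `5/2` enters.
    have hi : Integrable fun x : ℝ ↦ (1 + ‖x‖ ^ 2) ^ (-(2 * (s - 2)) / 2) := by
      apply integrable_rpow_neg_one_add_norm_sq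
      simp only [Module.finrank_self, Nat.cast_one]
      linarith
    refine hi.mono' (hcont.pow 2).aestronglyMeasurable (Eventually.of_forall fun x ↦ ?_)
    have h1 : (1 : ℝ) ≤ 1 + ‖x‖ ^ 2 := by nlinarith [sq_nonneg ‖x‖]
    have h0 : (0 : ℝ) < 1 + ‖x‖ ^ 2 := by linarith
    rw [Real.norm_of_nonneg (sq_nonneg _), mul_pow, ← pow_mul]
    have e1 : ((1 + ‖x‖ ^ 2) ^ (-s / 2)) ^ 2 = (1 + ‖x‖ ^ 2) ^ (-s) := by
      rw [← Real.rpow_mul_natCast h0.le]; congr 1; push_cast; ring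
    have e2 : x ^ (k * 2) ≤ (1 + ‖x‖ ^ 2) ^ (2 : ℝ) := by
      have : x ^ (k * 2) = (‖x‖ ^ 2) ^ k := by
        rw [Real.norm_eq_abs, sq_abs, ← pow_mul, mul_comm]
      rw [this]
      calc (‖x‖ ^ 2) ^ k ≤ (1 + ‖x‖ ^ 2) ^ k := by gcongr; linarith
        _ ≤ (1 + ‖x‖ ^ 2) ^ 2 := pow_le_pow_right₀ h1 hk
        _ = _ := by norm_cast
    calc x ^ (k * 2) * ((1 + ‖x‖ ^ 2) ^ (-s / 2)) ^ 2
        ≤ (1 + ‖x‖ ^ 2) ^ (2 : ℝ) * (1 + ‖x‖ ^ 2) ^ (-s) := by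
          rw [e1]; exact mul_le_mul_of_nonneg_right e2 (by positivity)
      _ = _ := by rw [← Real.rpow_add h0]; congr 1; ring
  have := hm.ofReal (K := ℂ) |>.integrable_mul (Lp.memLp W)
  refine this.congr (Eventually.of_forall fun x ↦ ?_)
  simp [mul_assoc]

/-- A function in `H^s(ℝ)` is almost everywhere the Fourier integral of a function with finite
moments up to order `2`, as soon as `s > 5/2`. -/
theorem MemHs.exists_ae_eq_fourier {s : ℝ} (hs : 5 / 2 < s) {u : ℝ → ℝ} (hu : MemHs s u) :
    ∃ V : ℝ → ℂ, (∀ k ≤ 2, Integrable fun x : ℝ ↦ ((x ^ k : ℝ) : ℂ) * V x) ∧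
      (fun x ↦ (u x : ℂ)) =ᵐ[volume] 𝓕 V := by
  obtain ⟨hu2, hu⟩ := hu
  obtain ⟨W, hW⟩ := TemperedDistribution.memSobolev_iff_exists_smulLeftCLM_fourier.mp hu
  set R : ℝ → ℂ := fun x ↦ ((((1 + ‖x‖ ^ 2) ^ (-s / 2) : ℝ) : ℂ) * W x) with hR
  have hRi := fun k hk ↦ integrable_pow_mul_rpow_mul hs k hk W
  have hR0 : Integrable R := by simpa [hR] using hRi 0 (by norm_num)
  -- The reflection turns the inverse transform of `R` into a forward one.
  refine ⟨fun x ↦ R (-x), fun k hk ↦ ?_, ?_⟩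
  · have := ((hRi k hk).comp_neg).const_mul ((-1 : ℂ) ^ k)
    refine this.congr (Eventually.of_forall fun x ↦ ?_)
    simp only [hR]
    push_cast
    rw [← mul_assoc, ← mul_pow]
    simp
  have hFR : 𝓕 (fun x ↦ R (-x)) = 𝓕⁻ R := (Real.fourierInv_eq_fourier_comp_neg R).symm
  rw [hFR]
  have hcont : Continuous (𝓕⁻ R) := by
    rw [← hFR]
    exact VectorFourier.fourierIntegral_continuous Real.continuous_fourierChar
      (by exact continuous_inner) hR0.comp_neg
  have hdist : 𝓕 (toL2 u : 𝓢'(ℝ, ℂ)) = TemperedDistribution.smulLeftCLM ℂ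
      (fun x : ℝ ↦ (((1 + ‖x‖ ^ 2) ^ (-s / 2) : ℝ) : ℂ)) (W : 𝓢'(ℝ, ℂ)) := by
    rw [← hW, TemperedDistribution.smulLeftCLM_smulLeftCLM_apply (by fun_prop) (by fun_prop)]
    convert! (TemperedDistribution.smulLeftCLM_const 1 (𝓕 (toL2 u : 𝓢'(ℝ, ℂ)))).symm using 1
    · simp
    · congr
      ext x
      rw [Pi.mul_apply]
      norm_cast
      rw [← Real.rpow_add (by positivity)]
      ring_nf
      simp
  -- Both sides are the same pairing with `W`: the transform is moved from the test function onto
  -- `R`, which is integrable.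
  have htest : ∀ φ : 𝓢(ℝ, ℂ), ∫ x, φ x • (u x : ℂ) = ∫ x, φ x • 𝓕⁻ R x := by
    intro φ
    have h1 : (toL2 u : 𝓢'(ℝ, ℂ)) φ = 𝓕 (toL2 u : 𝓢'(ℝ, ℂ)) (𝓕⁻ φ) := by
      rw [TemperedDistribution.fourier_apply, FourierTransform.fourier_fourierInv_eq]
    rw [Lp.toTemperedDistribution_apply, hdist, TemperedDistribution.smulLeftCLM_apply_apply,
      Lp.toTemperedDistribution_apply] at h1
    have h2 : ∫ x, φ x • (u x : ℂ) = ∫ x, φ x • toL2 u x := by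
      apply integral_congr_ae
      have : (toL2 u : ℝ → ℂ) =ᵐ[volume] fun x ↦ (u x : ℂ) := by
        rw [toL2, dif_pos hu2]; exact hu2.coeFn_toLp
      filter_upwards [this] with x hx
      rw [hx]
    rw [h2, h1]
    have h3 : ∀ x : ℝ, (SchwartzMap.smulLeftCLM ℂ
        (fun x : ℝ ↦ (((1 + ‖x‖ ^ 2) ^ (-s / 2) : ℝ) : ℂ)) (𝓕⁻ φ)) x • W x
        = (𝓕⁻ (φ : ℝ → ℂ)) x • R x := by
      intro x
      rw [SchwartzMap.smulLeftCLM_apply_apply (by fun_prop), SchwartzMap.fourierInv_coe]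
      simp only [hR, smul_eq_mul]
      ring
    simp_rw [h3, Real.fourierInv_eq_fourier_comp_neg]
    have := VectorFourier.integral_fourierIntegral_smul_eq_flip (L := innerₗ ℝ)
      (μ := volume) (ν := volume) Real.continuous_fourierChar continuous_inner
      (f := fun x ↦ φ (-x)) (g := R) (by exact φ.integrable.comp_neg) hR0
    rw [flip_innerₗ] at this
    change ∫ ξ, 𝓕 (fun x ↦ φ (-x)) ξ • R ξ = ∫ x, φ (-x) • 𝓕 R x at this
    rw [this, ← integral_neg_eq_self]
    congr 1 with x
    rw [neg_neg, ← Real.fourierInv_eq_fourier_comp_neg, Real.fourierInv_eq_fourier_neg]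
  refine ae_eq_of_integral_contDiff_smul_eq (hu2.locallyIntegrable (by norm_num))
    hcont.locallyIntegrable fun g g_smooth g_cpt ↦ ?_
  have hg₁ : HasCompactSupport (Complex.ofRealCLM ∘ g) := g_cpt.comp_left rfl
  have hg₂ : ContDiff ℝ ∞ (Complex.ofRealCLM ∘ g) := by fun_prop
  simpa using htest (hg₁.toSchwartzMap hg₂)

/-- Sobolev embedding: a continuous function in `H^s(ℝ)`, `s > 5/2`, is twice differentiable, and
it and its derivative vanish at infinity. -/
theorem MemHs.exists_hasDerivAt {s : ℝ} (hs : 5 / 2 < s) {u : ℝ → ℝ} (hu : MemHs s u)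
    (hc : Continuous u) :
    ∃ v w : ℝ → ℝ, (∀ x, HasDerivAt u (v x) x) ∧ (∀ x, HasDerivAt v (w x) x) ∧
      Tendsto u (cocompact ℝ) (𝓝 0) ∧ Tendsto v (cocompact ℝ) (𝓝 0) := by
  obtain ⟨V, hV, hae⟩ := hu.exists_ae_eq_fourier hs
  have hV0 : Integrable V := by simpa using hV 0 (by norm_num)
  have hV1 : Integrable fun x : ℝ ↦ x • V x := by
    simpa using hV 1 (by norm_num)
  set V₁ : ℝ → ℂ := fun x : ℝ ↦ (-2 * Real.pi * Complex.I * x) • V x with hV₁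
  have hV10 : Integrable V₁ := by
    refine (hV1.const_mul (-2 * Real.pi * Complex.I)).congr (Eventually.of_forall fun x ↦ ?_)
    simp only [hV₁, smul_eq_mul, Complex.real_smul]
    ring
  have hV11 : Integrable fun x : ℝ ↦ x • V₁ x := by
    refine ((hV 2 le_rfl).const_mul (-2 * Real.pi * Complex.I)).congr
      (Eventually.of_forall fun x ↦ ?_)
    simp only [hV₁, smul_eq_mul, Complex.real_smul]
    push_cast
    ring
  have hd0 := Real.hasDerivAt_fourier hV0 hV1
  have hd1 := Real.hasDerivAt_fourier hV10 hV11
  have hcF : Continuous (𝓕 V) :=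
    continuous_iff_continuousAt.mpr fun x ↦ (hd0 x).continuousAt
  have heq : (fun x ↦ (u x : ℂ)) = 𝓕 V :=
    Continuous.ae_eq_iff_eq volume (by fun_prop) hcF |>.mp hae
  have hu_eq : u = fun x ↦ (𝓕 V x).re := by
    ext x; rw [← heq]; simp
  have hre : ∀ {f : ℝ → ℂ} {f' : ℂ} {x : ℝ}, HasDerivAt f f' x →
      HasDerivAt (fun x ↦ (f x).re) f'.re x := fun h ↦
    (Complex.reCLM.hasFDerivAt.comp_hasDerivAt _ h)
  have htend : ∀ f : ℝ → ℂ, Tendsto (fun x ↦ (𝓕 f x).re) (cocompact ℝ) (𝓝 0) := fun f ↦ by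
    simpa [Function.comp_def] using (Complex.continuous_re.tendsto 0).comp (Real.zero_at_infty_fourier f)
  refine ⟨fun x ↦ (𝓕 V₁ x).re, fun x ↦ (𝓕 (fun x : ℝ ↦ (-2 * Real.pi * Complex.I * x) • V₁ x) x).re,
    fun x ↦ ?_, fun x ↦ hre (hd1 x), ?_, htend V₁⟩
  · rw [hu_eq]; exact hre (hd0 x)
  · rw [hu_eq]; exact htend V

/-! ### Algebra of the density of `H₂` -/

/-- The density of `H₂` as a homogeneous polynomial in `(u, u_x)`. -/
noncomputable def density (n : ℕ) (y p : ℝ) : ℝ :=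
  ∑ k ∈ Finset.range (n + 1), (-1 : ℝ) ^ (k + 1) / (2 * (k : ℝ) - 1) * (n.choose k : ℝ) *
    y ^ (2 * (n - k) + 1) * p ^ (2 * k)

theorem density_eq (n : ℕ) (y p : ℝ) :
    density n y p = y ^ (2 * n + 1) +
      ∑ k ∈ Finset.Icc 1 n, (-1 : ℝ) ^ (k + 1) / (2 * (k : ℝ) - 1) * (n.choose k : ℝ) *
        y ^ (2 * (n - k) + 1) * p ^ (2 * k) := by
  rw [density, Finset.range_eq_Ico, Finset.sum_eq_sum_Ico_succ_bot (by omega)]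
  congr 1
  simp

theorem H2_eq_integral_density (n : ℕ) (u : ℝ → ℝ) :
    H2 n u = ∫ x, density n (u x) (deriv u x) := by
  simp_rw [H2, density_eq]

/-- This recursion drives the sharp bound: for `|p| ≤ y` the subtracted term is nonnegative, and it
vanishes when `|p| = y`. -/
theorem density_succ (n : ℕ) (y p : ℝ) :
    (2 * (n : ℝ) + 1) * density (n + 1) y p =
      (2 * (n : ℝ) + 2) * y ^ 2 * density n y p - y * (y ^ 2 - p ^ 2) ^ (n + 1) := by
  -- The added term `k = n + 1` is zero because its binomial coefficient is.
  have hext : density n y p = ∑ k ∈ Finset.range (n + 2), (-1 : ℝ) ^ (k + 1) /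
      (2 * (k : ℝ) - 1) * (n.choose k : ℝ) * y ^ (2 * (n - k) + 1) * p ^ (2 * k) := by
    rw [Finset.sum_range_succ _ (n + 1), density]
    simp
  have hbin : (y ^ 2 - p ^ 2) ^ (n + 1) = ∑ k ∈ Finset.range (n + 2),
      (-p ^ 2) ^ k * (y ^ 2) ^ (n + 1 - k) * ((n + 1).choose k : ℝ) := by
    rw [← add_pow]; congr 1; ring
  rw [hext, hbin, density, Finset.mul_sum, Finset.mul_sum, Finset.mul_sum,
    ← Finset.sum_sub_distrib]
  refine Finset.sum_congr rfl fun k hk ↦ ?_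
  have hneg : (-p ^ 2) ^ k = (-1 : ℝ) ^ k * p ^ (2 * k) := by
    rw [neg_pow, ← pow_mul]
  have hk' : (2 * (k : ℝ) - 1) ≠ 0 := by
    intro h
    have : (2 * k : ℤ) = 1 := by exact_mod_cast (by linarith : 2 * (k : ℝ) = 1)
    omega
  rcases Nat.lt_or_ge n k with h | h
  · obtain rfl : k = n + 1 := by simp at hk; omega
    rw [hneg]
    push_cast at hk' ⊢
    simp only [Nat.choose_self, Nat.choose_succ_self, tsub_self]
    field_simp
    push_cast
    ring
  · obtain ⟨j, rfl⟩ := Nat.exists_eq_add_of_le h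
    have e1 : k + j + 1 - k = j + 1 := by omega
    have e2 : k + j - k = j := by omega
    have hch : ((k + j).choose k : ℝ) * (k + j + 1) = ((k + j + 1).choose k : ℝ) * (j + 1) := by
      have := Nat.choose_mul_succ_eq (k + j) k
      rw [e1] at this
      exact_mod_cast this
    rw [hneg, e1, e2]
    push_cast
    field_simp
    linear_combination (-2 * y ^ (2 * j + 3) * (-1 : ℝ) ^ (k + 1) * p ^ (2 * k)) * hch

theorem density_one (y p : ℝ) : density 1 y p = y ^ 3 + y * p ^ 2 := by
  norm_num [density, Finset.sum_range_succ]

theorem density_of_sq_eq_sq (n : ℕ) {y p : ℝ} (h : p ^ 2 = y ^ 2) :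
    density n y p = density n 1 1 * y ^ (2 * n + 1) := by
  rw [density, density, Finset.sum_mul]
  refine Finset.sum_congr rfl fun k hk ↦ ?_
  obtain ⟨j, rfl⟩ := Nat.exists_eq_add_of_le (Nat.lt_succ_iff.mp (Finset.mem_range.mp hk))
  rw [pow_mul p, h, ← pow_mul, Nat.add_sub_cancel_left]
  ring

theorem density_succ_one_one (n : ℕ) :
    (2 * (n : ℝ) + 1) * density (n + 1) 1 1 = (2 * (n : ℝ) + 2) * density n 1 1 := by
  rw [density_succ]; simp

theorem two_le_density_one_one (m : ℕ) : 2 ≤ density (m + 1) 1 1 := by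
  induction m with
  | zero => norm_num [density_one]
  | succ m ih =>
    have h := density_succ_one_one (m + 1)
    push_cast at h
    have hm : (0 : ℝ) ≤ m := m.cast_nonneg
    nlinarith

/-- The density is at most the quadratic form with the same value at `|p| = y`. -/
theorem two_mul_density_le (m : ℕ) {y p : ℝ} (h : |p| ≤ y) :
    2 * density (m + 1) y p ≤ density (m + 1) 1 1 * (y ^ (2 * m + 1) * (y ^ 2 + p ^ 2)) := by
  have hy : 0 ≤ y := (abs_nonneg p).trans h
  have hp : 0 ≤ y ^ 2 - p ^ 2 := sub_nonneg.mpr (sq_le_sq.mpr (by rwa [abs_of_nonneg hy]))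
  induction m with
  | zero =>
    simp only [zero_add, density_one]
    apply le_of_eq
    ring
  | succ m ih =>
    have h1 := density_succ (m + 1) y p
    have h2 := density_succ_one_one (m + 1)
    push_cast at h1 h2
    have hm : (0 : ℝ) < 2 * (m + 1) + 1 := by positivity
    have h3 : 0 ≤ y * (y ^ 2 - p ^ 2) ^ (m + 1 + 1) := by positivity
    refine le_of_mul_le_mul_left ?_ hm
    have h4 := mul_le_mul_of_nonneg_left ih
      (by positivity : 0 ≤ (2 * ((m : ℝ) + 1) + 2) * y ^ 2)
    have h5 : (2 * ((m : ℝ) + 1) + 1) *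
        (density (m + 1 + 1) 1 1 * (y ^ (2 * (m + 1) + 1) * (y ^ 2 + p ^ 2))) =
        (2 * ((m : ℝ) + 1) + 2) * y ^ 2 *
          (density (m + 1) 1 1 * (y ^ (2 * m + 1) * (y ^ 2 + p ^ 2))) := by
      rw [← mul_assoc, h2]; ring
    rw [h5]
    linarith

/-! ### Injectivity of the speed -/

/-- The sum `σ_n` is `∫₀¹ (1 - t²)^n dt`. Positivity follows from the recursion `(2n+3) σ_{n+1} =
(2n+2) σ_n`, whose two sides differ by an alternating sum of binomial coefficients, which is zero.
-/
theorem speed_coeff_pos (n : ℕ) :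
    0 < ∑ k ∈ Finset.range (n + 1), (-1 : ℝ) ^ k / (2 * (k : ℝ) + 1) * (n.choose k : ℝ) := by
  induction n with
  | zero => simp
  | succ n ih =>
    set σ := ∑ k ∈ Finset.range (n + 1), (-1 : ℝ) ^ k / (2 * (k : ℝ) + 1) * (n.choose k : ℝ)
      with hσ
    have hext : σ = ∑ k ∈ Finset.range (n + 2),
        (-1 : ℝ) ^ k / (2 * (k : ℝ) + 1) * (n.choose k : ℝ) := by
      rw [Finset.sum_range_succ _ (n + 1)]; simp [hσ]
    have halt : ∑ k ∈ Finset.range (n + 2), (-1 : ℝ) ^ k * ((n + 1).choose k : ℝ) = 0 := by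
      exact_mod_cast Int.alternating_sum_range_choose_of_ne (n := n + 1) (by omega)
    have hrec : (2 * (n : ℝ) + 3) * ∑ k ∈ Finset.range (n + 2),
        (-1 : ℝ) ^ k / (2 * (k : ℝ) + 1) * ((n + 1).choose k : ℝ) = (2 * (n : ℝ) + 2) * σ := by
      rw [← sub_eq_zero, hext, Finset.mul_sum, Finset.mul_sum, ← Finset.sum_sub_distrib, ← halt]
      refine Finset.sum_congr rfl fun k hk ↦ ?_
      have hle : k ≤ n + 1 := Nat.lt_succ_iff.mp (Finset.mem_range.mp hk)
      have hch : (n.choose k : ℝ) * (n + 1) = ((n + 1).choose k : ℝ) * (n + 1 - k) := by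
        have := Nat.choose_mul_succ_eq n k
        have h' : ((n + 1 - k : ℕ) : ℝ) = n + 1 - k := by push_cast [Nat.cast_sub hle]; ring
        rw [← h']
        exact_mod_cast this
      have hk' : (2 * (k : ℝ) + 1) ≠ 0 := by positivity
      field_simp
      linear_combination (-2 : ℝ) * hch
    have : 0 < (2 * (n : ℝ) + 2) * σ := by positivity
    rw [← hrec] at this
    exact pos_of_mul_pos_right this (by positivity)

theorem peakonSpeed_injOn {n : ℕ} (hn : 1 ≤ n) : Set.InjOn (peakonSpeed n) (Set.Ioi 0) := by
  intro a ha b hb h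
  have hpos := speed_coeff_pos n
  have hc : (1 + 1 / (2 * (n : ℝ))) * ∑ k ∈ Finset.range (n + 1),
      (-1 : ℝ) ^ k / (2 * (k : ℝ) + 1) * (n.choose k : ℝ) ≠ 0 := by positivity
  have h' : a ^ (2 * n - 1) = b ^ (2 * n - 1) := mul_left_cancel₀ hc h
  exact (pow_left_inj₀ (le_of_lt ha) (le_of_lt hb) (by omega)).mp h'

/-! ### The polynomial with a double zero -/

/-- The quotient `(t^{j+1} - 1)/(t - 1) = 1 + t + ⋯ + t^j` is at least `1`. -/
theorem sub_one_sq_le_mul_pow_sub_one {t : ℝ} (ht : 0 ≤ t) (j : ℕ) :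
    (t - 1) ^ 2 ≤ (t - 1) * (t ^ (j + 1) - 1) := by
  induction j with
  | zero => apply le_of_eq; ring
  | succ j ih =>
    have h := mul_nonneg ht ((sq_nonneg (t - 1)).trans ih)
    have e : (t - 1) * (t ^ (j + 1 + 1) - 1) =
        t * ((t - 1) * (t ^ (j + 1) - 1)) + (t - 1) ^ 2 := by ring
    linarith

/-- The trinomial `m tᵐ⁺² - (m+2) tᵐ + 2` has its double zero at `1` as its only zero in
`[0, ∞)`. -/
theorem two_mul_sub_one_sq_le_trinomial {t : ℝ} (ht : 0 ≤ t) (m : ℕ) :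
    2 * (t - 1) ^ 2 ≤ ((m : ℝ) + 1) * t ^ (m + 3) - ((m : ℝ) + 3) * t ^ (m + 1) + 2 := by
  -- Each trinomial is `t` times the preceding one plus two products that are each at least `(t -
  -- 1)²`. The induction starts from `m = 0`, where the trinomial is identically `0`.
  have step (f : ℝ) (m : ℕ) (hf : 0 ≤ f)
      (h : f = (m : ℝ) * t ^ (m + 2) - ((m : ℝ) + 2) * t ^ m + 2) :
      2 * (t - 1) ^ 2 ≤ ((m : ℝ) + 1) * t ^ (m + 3) - ((m : ℝ) + 3) * t ^ (m + 1) + 2 := by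
    have h1 := sub_one_sq_le_mul_pow_sub_one ht m
    have h2 := sub_one_sq_le_mul_pow_sub_one ht (m + 1)
    have h3 := mul_nonneg ht hf
    have e : ((m : ℝ) + 1) * t ^ (m + 3) - ((m : ℝ) + 3) * t ^ (m + 1) + 2 =
        t * f + (t - 1) * (t ^ (m + 1) - 1) + (t - 1) * (t ^ (m + 1 + 1) - 1) := by
      rw [h]; ring
    linarith
  induction m with
  | zero => exact step 0 0 le_rfl (by norm_num)
  | succ m ih =>
    refine step _ (m + 1) ((by positivity : 0 ≤ 2 * (t - 1) ^ 2).trans ih) ?_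
    push_cast
    ring

theorem two_mul_pow_mul_sub_sq_le {a M : ℝ} (ha : 0 < a) (hM : 0 ≤ M) (m : ℕ) :
    2 * a ^ (2 * m + 1) * (M - a) ^ 2 ≤ (2 * (m : ℝ) + 1) * M ^ (2 * m + 3) -
      (2 * (m : ℝ) + 3) * a ^ 2 * M ^ (2 * m + 1) + 2 * a ^ (2 * m + 3) := by
  obtain ⟨t, rfl⟩ : ∃ t, M = t * a := ⟨M / a, by field_simp⟩
  have ht : 0 ≤ t := nonneg_of_mul_nonneg_left hM ha
  have h := mul_le_mul_of_nonneg_right (two_mul_sub_one_sq_le_trinomial ht (2 * m))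
    (by positivity : 0 ≤ a ^ (2 * m + 3))
  push_cast at h
  calc _ = 2 * (t - 1) ^ 2 * a ^ (2 * m + 3) := by ring
    _ ≤ _ := h
    _ = _ := by ring

/-! ### Functionals of the peakon -/

theorem deriv_peakon_sq {a x : ℝ} (hx : x ≠ 0) : deriv (peakon a) x ^ 2 = peakon a x ^ 2 := by
  rcases lt_or_gt_of_ne hx with h | h
  · have : HasDerivAt (peakon a) (a * Real.exp x) x := by
      refine ((Real.hasDerivAt_exp x).const_mul a).congr_of_eventuallyEq ?_
      filter_upwards [Iio_mem_nhds h] with y hy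
      simp [peakon, abs_of_neg (Set.mem_Iio.mp hy)]
    rw [this.deriv, peakon, abs_of_neg h, neg_neg]
  · have : HasDerivAt (peakon a) (a * (Real.exp (-x) * -1)) x := by
      refine ((hasDerivAt_neg x).exp.const_mul a).congr_of_eventuallyEq ?_
      filter_upwards [Ioi_mem_nhds h] with y hy
      simp [peakon, abs_of_pos (Set.mem_Ioi.mp hy)]
    rw [this.deriv, peakon, abs_of_pos h]
    ring

theorem integral_peakon_pow (a : ℝ) {j : ℕ} (hj : j ≠ 0) :
    ∫ x, peakon a x ^ j = 2 * a ^ j / j := by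
  have hj' : (0 : ℝ) < j := by positivity
  have h1 : ∀ x, peakon a x ^ j = (fun y ↦ a ^ j * Real.exp (-(j : ℝ) * y)) |x| := fun x ↦ by
    simp only [peakon, mul_pow, ← Real.exp_nat_mul]
    congr 2
    ring
  simp_rw [h1]
  rw [integral_comp_abs (f := fun y ↦ a ^ j * Real.exp (-(j : ℝ) * y)), integral_const_mul,
    integral_exp_mul_Ioi (by linarith)]
  simp
  field_simp

theorem H1_peakon (a : ℝ) : H1 (peakon a) = 2 * a ^ 2 := by
  have : H1 (peakon a) = ∫ x, 2 * peakon a x ^ 2 := by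
    refine integral_congr_ae ?_
    filter_upwards [compl_mem_ae_iff.mpr (measure_singleton (0 : ℝ))] with x hx
    rw [deriv_peakon_sq hx]
    ring
  rw [this, integral_const_mul, integral_peakon_pow a two_ne_zero]
  push_cast
  ring

theorem H2_peakon (n : ℕ) (a : ℝ) :
    H2 n (peakon a) = 2 * density n 1 1 * a ^ (2 * n + 1) / (2 * n + 1) := by
  have : H2 n (peakon a) = ∫ x, density n 1 1 * peakon a x ^ (2 * n + 1) := by
    rw [H2_eq_integral_density]
    refine integral_congr_ae ?_
    filter_upwards [compl_mem_ae_iff.mpr (measure_singleton (0 : ℝ))] with x hx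
    exact density_of_sq_eq_sq n (deriv_peakon_sq hx)
  rw [this, integral_const_mul, integral_peakon_pow a (by omega)]
  push_cast
  ring

/-! ### Inequalities between `H₁`, `H₂` and the maximum -/

/-- A function with nonnegative momentum that vanishes at infinity with its derivative dominates
the absolute value of its derivative. -/
theorem abs_deriv_le_of_momentum_nonneg {u v w : ℝ → ℝ} (hu : ∀ x, HasDerivAt u (v x) x)
    (hv : ∀ x, HasDerivAt v (w x) x) (hu0 : Tendsto u (cocompact ℝ) (𝓝 0))
    (hv0 : Tendsto v (cocompact ℝ) (𝓝 0)) (hm : ∀ x, 0 ≤ u x - w x) (x : ℝ) : |v x| ≤ u x := by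
  have hd1 : ∀ x, HasDerivAt (fun x ↦ Real.exp x * (u x - v x)) (Real.exp x * (u x - w x)) x := by
    intro x
    refine ((Real.hasDerivAt_exp x).mul ((hu x).sub (hv x))).congr_deriv ?_
    simp only [Pi.sub_apply]
    ring
  have hd2 : ∀ x, HasDerivAt (fun x ↦ Real.exp (-x) * (u x + v x))
      (-(Real.exp (-x) * (u x - w x))) x := by
    intro x
    refine ((hasDerivAt_neg x).exp.mul ((hu x).add (hv x))).congr_deriv ?_
    simp only [Pi.add_apply]
    ring
  have hmono : Monotone fun x ↦ Real.exp x * (u x - v x) :=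
    monotone_of_hasDerivAt_nonneg hd1 fun x ↦ mul_nonneg (Real.exp_pos x).le (hm x)
  have hanti : Antitone fun x ↦ Real.exp (-x) * (u x + v x) :=
    antitone_of_hasDerivAt_nonpos hd2 fun x ↦
      neg_nonpos.mpr (mul_nonneg (Real.exp_pos _).le (hm x))
  have ht1 : Tendsto (fun x ↦ Real.exp x * (u x - v x)) atBot (𝓝 0) := by
    simpa using Real.tendsto_exp_atBot.mul
      ((hu0.mono_left atBot_le_cocompact).sub (hv0.mono_left atBot_le_cocompact))
  have ht2 : Tendsto (fun x ↦ Real.exp (-x) * (u x + v x)) atTop (𝓝 0) := by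
    simpa using (Real.tendsto_exp_atBot.comp tendsto_neg_atTop_atBot).mul
      ((hu0.mono_left atTop_le_cocompact).add (hv0.mono_left atTop_le_cocompact))
  have h1 := nonneg_of_mul_nonneg_right (hmono.le_of_tendsto ht1 x) (Real.exp_pos x)
  have h2 := nonneg_of_mul_nonneg_right (hanti.le_of_tendsto ht2 x) (Real.exp_pos (-x))
  rw [abs_le]
  constructor <;> linarith

/-- Comparison of integrals over the line when the integrands differ by a derivative, up to a
change of sign at one point. -/
theorem integral_le_two_mul_add_integral {A B F f : ℝ → ℝ} (hA : Integrable A) (hB : Integrable B)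
    (hf : Integrable f) (hF : ∀ x, HasDerivAt F (f x) x) (hF0 : Tendsto F (cocompact ℝ) (𝓝 0))
    (h1 : ∀ x, A x ≤ f x + B x) (h2 : ∀ x, A x ≤ -f x + B x) (ξ : ℝ) :
    ∫ x, A x ≤ 2 * F ξ + ∫ x, B x := by
  have hl : ∫ x in Set.Iic ξ, f x = F ξ - 0 := integral_Iic_of_hasDerivAt_of_tendsto'
    (fun x _ ↦ hF x) hf.integrableOn (hF0.mono_left atBot_le_cocompact)
  have hr : ∫ x in Set.Ioi ξ, f x = 0 - F ξ := integral_Ioi_of_hasDerivAt_of_tendsto'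
    (fun x _ ↦ hF x) hf.integrableOn (hF0.mono_left atTop_le_cocompact)
  have i1 : ∫ x in Set.Iic ξ, A x ≤ ∫ x in Set.Iic ξ, (f x + B x) :=
    integral_mono hA.integrableOn (hf.add hB).integrableOn h1
  have i2 : ∫ x in Set.Ioi ξ, A x ≤ ∫ x in Set.Ioi ξ, (-f x + B x) :=
    integral_mono hA.integrableOn (hf.neg.add hB).integrableOn h2
  rw [integral_add hf.integrableOn hB.integrableOn, hl] at i1
  rw [integral_add (f := fun x ↦ -f x) hf.neg.integrableOn hB.integrableOn, integral_neg,
    hr] at i2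
  rw [← intervalIntegral.integral_Iic_add_Ioi hA.integrableOn hA.integrableOn (b := ξ),
    ← intervalIntegral.integral_Iic_add_Ioi hB.integrableOn hB.integrableOn (b := ξ)]
  linarith

/-- Domination by `M^{i+j-2} u²`: square integrability of `u` alone suffices, since `v` is bounded
by `u`. -/
theorem integrable_pow_mul_pow {u v : ℝ → ℝ} (hu : Continuous u) (hv : Continuous v)
    (hu2 : Integrable fun x ↦ u x ^ 2) (hvu : ∀ x, |v x| ≤ u x) {M : ℝ} (hM : ∀ x, u x ≤ M)
    {i j : ℕ} (hij : 2 ≤ i + j) : Integrable fun x ↦ u x ^ i * v x ^ j := by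
  refine (hu2.const_mul (M ^ (i + j - 2))).mono' (by fun_prop) (Eventually.of_forall fun x ↦ ?_)
  have h0 : 0 ≤ u x := (abs_nonneg _).trans (hvu x)
  rw [norm_mul, norm_pow, norm_pow, Real.norm_of_nonneg h0, Real.norm_eq_abs]
  calc u x ^ i * |v x| ^ j ≤ u x ^ i * u x ^ j := by gcongr; exact hvu x
    _ = u x ^ (i + j - 2) * u x ^ 2 := by rw [← pow_add, ← pow_add]; congr 1; omega
    _ ≤ _ := by gcongr; exact hM x

section Bounds

variable {u v : ℝ → ℝ} {ξ : ℝ}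

/-- The energy controls the maximum. -/
theorem two_mul_sq_le_H1 (hu : ∀ x, HasDerivAt u (v x) x) (hv : Continuous v)
    (hu0 : Tendsto u (cocompact ℝ) (𝓝 0)) (hu2 : Integrable fun x ↦ u x ^ 2)
    (hvu : ∀ x, |v x| ≤ u x) (hξ : ∀ x, u x ≤ u ξ) : 2 * u ξ ^ 2 ≤ H1 u := by
  have hc : Continuous u := continuous_iff_continuousAt.mpr fun x ↦ (hu x).continuousAt
  have hint := fun i j ↦ integrable_pow_mul_pow (i := i) (j := j) hc hv hu2 hvu hξ
  have hB : Integrable fun x ↦ u x ^ 2 + v x ^ 2 :=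
    hu2.add (by simpa using hint 0 2 (by norm_num))
  have hf : Integrable fun x ↦ -2 * (u x * v x) := by
    simpa using (hint 1 1 (by norm_num)).const_mul (-2)
  -- The squares `(u - v)²` left of `ξ` and `(u + v)²` right of it are nonnegative; their cross
  -- terms integrate to `-u ξ ^ 2` each.
  have key := integral_le_two_mul_add_integral (A := fun _ ↦ 0) (F := fun x ↦ -u x ^ 2)
    (integrable_zero _ _ _) hB hf (fun x ↦ ((hu x).pow 2).neg.congr_deriv (by ring))
    (by simpa using (hu0.pow 2).neg) (fun x ↦ by nlinarith [sq_nonneg (u x - v x)])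
    (fun x ↦ by nlinarith [sq_nonneg (u x + v x)]) ξ
  have hd : deriv u = v := funext fun x ↦ (hu x).deriv
  rw [H1, hd]
  rw [integral_zero] at key
  linarith

/-- The sharp inequality between `H₂`, `H₁` and the maximum. Peakons are extremal. -/
theorem H2_le (hu : ∀ x, HasDerivAt u (v x) x) (hv : Continuous v)
    (hu0 : Tendsto u (cocompact ℝ) (𝓝 0)) (hu2 : Integrable fun x ↦ u x ^ 2)
    (hvu : ∀ x, |v x| ≤ u x) (hξ : ∀ x, u x ≤ u ξ) (m : ℕ) :
    H2 (m + 1) u ≤ density (m + 1) 1 1 * (2 / (2 * m + 3) * u ξ ^ (2 * m + 3) +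
      u ξ ^ (2 * m + 1) / 2 * (H1 u - 2 * u ξ ^ 2)) := by
  have hc : Continuous u := continuous_iff_continuousAt.mpr fun x ↦ (hu x).continuousAt
  have hpos : ∀ x, 0 ≤ u x := fun x ↦ (abs_nonneg _).trans (hvu x)
  have hint := fun i j ↦ integrable_pow_mul_pow (i := i) (j := j) hc hv hu2 hvu hξ
  have hd : deriv u = v := funext fun x ↦ (hu x).deriv
  set S := density (m + 1) 1 1 with hS
  have hS0 : 0 ≤ S := zero_le_two.trans (two_le_density_one_one m)
  set M := u ξ with hM
  have hA : Integrable fun x ↦ density (m + 1) (u x) (v x) := by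
    simp only [density]
    refine integrable_finsetSum _ fun k hk ↦ ?_
    simp_rw [mul_assoc _ (_ ^ (2 * (m + 1 - k) + 1)) _]
    refine (hint _ _ ?_).const_mul _
    simp at hk
    omega
  have hB : Integrable fun x ↦ S * (M ^ (2 * m + 1) / 2) * (u x ^ 2 + v x ^ 2) :=
    (hu2.add (by simpa using hint 0 2 (by norm_num))).const_mul _
  have hf : Integrable fun x ↦
      S * (u x ^ (2 * m + 2) * v x) - S * M ^ (2 * m + 1) * (u x * v x) := by
    refine Integrable.sub ?_ ?_
    · simpa using (hint (2 * m + 2) 1 (by omega)).const_mul S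
    · simpa using (hint 1 1 (by norm_num)).const_mul (S * M ^ (2 * m + 1))
  have hm : (2 * (m : ℝ) + 3) ≠ 0 := by positivity
  have hF : ∀ x, HasDerivAt
      (fun x ↦ S / (2 * m + 3) * u x ^ (2 * m + 3) - S * M ^ (2 * m + 1) / 2 * u x ^ 2)
      (S * (u x ^ (2 * m + 2) * v x) - S * M ^ (2 * m + 1) * (u x * v x)) x := by
    intro x
    refine ((((hu x).pow (2 * m + 3)).const_mul (S / (2 * m + 3))).sub
      (((hu x).pow 2).const_mul (S * M ^ (2 * m + 1) / 2))).congr_deriv ?_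
    push_cast
    field_simp
  -- Only the square `(u - p)²` has its weight raised to `M^{2m+1}`; the cross terms stay exact, and
  -- for `p = v` they form the derivative `f`. Right of `ξ` one takes `p = -v`, as the density is
  -- even in `p`.
  have hpt : ∀ x, ∀ p : ℝ, |p| ≤ u x → density (m + 1) (u x) p ≤
      (S * (u x ^ (2 * m + 2) * p) - S * M ^ (2 * m + 1) * (u x * p)) +
        S * (M ^ (2 * m + 1) / 2) * (u x ^ 2 + p ^ 2) := by
    intro x p hp
    have h1 := two_mul_density_le m hp
    have h2 : u x ^ (2 * m + 1) * (u x - p) ^ 2 ≤ M ^ (2 * m + 1) * (u x - p) ^ 2 :=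
      mul_le_mul_of_nonneg_right (pow_le_pow_left₀ (hpos x) (hξ x) _) (sq_nonneg _)
    have h3 := mul_le_mul_of_nonneg_left h2 hS0
    rw [← hS] at h1
    have e : S * (u x ^ (2 * m + 1) * (u x ^ 2 + p ^ 2)) =
        S * (u x ^ (2 * m + 1) * (u x - p) ^ 2) + 2 * (S * (u x ^ (2 * m + 2) * p)) := by ring
    have e' : S * (M ^ (2 * m + 1) * (u x - p) ^ 2) = 2 * (S * (M ^ (2 * m + 1) / 2) *
        (u x ^ 2 + p ^ 2)) - 2 * (S * M ^ (2 * m + 1) * (u x * p)) := by ring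
    linarith
  have heven : ∀ y p, density (m + 1) y (-p) = density (m + 1) y p := fun y p ↦ by
    simp only [density, pow_mul, neg_sq]
  have hFlim : Tendsto
      (fun x ↦ S / (2 * m + 3) * u x ^ (2 * m + 3) - S * M ^ (2 * m + 1) / 2 * u x ^ 2)
      (cocompact ℝ) (𝓝 0) := by
    have h1 := (hu0.pow (2 * m + 3)).const_mul (S / (2 * m + 3))
    have h2 := (hu0.pow 2).const_mul (S * M ^ (2 * m + 1) / 2)
    convert h1.sub h2 using 2
    simp
  have key := integral_le_two_mul_add_integral hA hB hf hF
    hFlim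
    (fun x ↦ hpt x (v x) (hvu x))
    (fun x ↦ by
      have := hpt x (-v x) (by rw [abs_neg]; exact hvu x)
      rw [heven, neg_sq] at this
      linarith) ξ
  rw [integral_const_mul] at key
  rw [H2_eq_integral_density, H1, hd]
  refine key.trans (le_of_eq ?_)
  rw [← hM]
  field_simp
  ring

end Bounds

/-! ### Stability estimate and modulus -/

/-- Stability of the maximum when the two functionals are close to those of a peakon. -/
theorem sub_sq_le {a M h₁ h₂ E₁ E₂ S : ℝ} {m : ℕ} (ha : 0 < a) (hM : 0 ≤ M) (hS : 0 < S)
    (hh : h₂ ≤ S * (2 / (2 * m + 3) * M ^ (2 * m + 3) + M ^ (2 * m + 1) / 2 * (h₁ - 2 * M ^ 2)))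
    (hE₁ : h₁ ≤ 2 * a ^ 2 + E₁) (hE₂ : 2 * S * a ^ (2 * m + 3) / (2 * m + 3) ≤ h₂ + E₂) :
    (M - a) ^ 2 ≤ (2 * m + 3) / (2 * S) * (E₂ / a ^ (2 * m + 1)) +
      (2 * m + 3) / 4 * (M ^ (2 * m + 1) / a ^ (2 * m + 1)) * E₁ := by
  have h1 := two_mul_pow_mul_sub_sq_le ha hM m
  have hm : (0 : ℝ) < 2 * m + 3 := by positivity
  have h2 : S * (M ^ (2 * m + 1) / 2 * (h₁ - 2 * M ^ 2)) ≤
      S * (M ^ (2 * m + 1) / 2 * (2 * a ^ 2 + E₁ - 2 * M ^ 2)) := by gcongr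
  -- The factor `S / (2m+3)` makes the polynomial equal to the peakon's `H₂` minus the upper bound
  -- for `H₂`, up to the `E₁` term.
  have h3 := mul_le_mul_of_nonneg_left h1 (by positivity : 0 ≤ S / (2 * m + 3))
  have h4 : S / (2 * m + 3) * ((2 * (m : ℝ) + 1) * M ^ (2 * m + 3) -
      (2 * (m : ℝ) + 3) * a ^ 2 * M ^ (2 * m + 1) + 2 * a ^ (2 * m + 3)) =
      2 * S * a ^ (2 * m + 3) / (2 * m + 3) - S * (2 / (2 * m + 3) * M ^ (2 * m + 3)) -
        S * (M ^ (2 * m + 1) / 2 * (2 * a ^ 2 + E₁ - 2 * M ^ 2)) +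
        S * (M ^ (2 * m + 1) / 2) * E₁ := by
    field_simp
    ring
  have h5 : S / (2 * m + 3) * (2 * a ^ (2 * m + 1) * (M - a) ^ 2) ≤
      E₂ + S * (M ^ (2 * m + 1) / 2) * E₁ := by
    rw [mul_add] at hh
    linarith
  have hc : 0 < S / (2 * m + 3) * (2 * a ^ (2 * m + 1)) := by positivity
  refine le_of_mul_le_mul_left ?_ hc
  refine (le_of_eq (by ring)).trans (h5.trans (le_of_eq ?_))
  field_simp
  ring

/-- A continuous positive function in `H^s(ℝ)`, `s > 5/2`, with nonnegative momentum attains its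
maximum, and the maximum satisfies the two inequalities of which peakons are the extremals. -/
theorem exists_isGreatest_and_le {s : ℝ} (hs : 5 / 2 < s) {u : ℝ → ℝ} (hc : Continuous u)
    (hu : MemHs s u) (hpos : ∀ x, 0 < u x) (hm : ∀ x, 0 ≤ momentum u x) :
    ∃ M : ℝ, IsGreatest (Set.range u) M ∧ 0 < M ∧ 2 * M ^ 2 ≤ H1 u ∧
      ∀ m : ℕ, H2 (m + 1) u ≤ density (m + 1) 1 1 * (2 / (2 * m + 3) * M ^ (2 * m + 3) +
        M ^ (2 * m + 1) / 2 * (H1 u - 2 * M ^ 2)) := by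
  obtain ⟨v, w, hv, hw, hu0, hv0⟩ := hu.exists_hasDerivAt hs hc
  have hd : deriv u = v := funext fun x ↦ (hv x).deriv
  have hdd : deriv v = w := funext fun x ↦ (hw x).deriv
  have hvu : ∀ x, |v x| ≤ u x := abs_deriv_le_of_momentum_nonneg hv hw hu0 hv0 fun x ↦ by
    simpa [momentum, hd, hdd] using hm x
  have hvc : Continuous v := continuous_iff_continuousAt.mpr fun x ↦ (hw x).continuousAt
  have hu2 : Integrable fun x ↦ u x ^ 2 := by
    have h := (memLp_two_iff_integrable_sq_norm hu.1.aestronglyMeasurable).mp hu.1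
    simpa using h
  -- Decay puts `u` below `u 0 > 0` outside a compact set.
  obtain ⟨ξ, hξ⟩ := hc.exists_forall_ge' 0
    ((hu0.eventually_lt_const (hpos 0)).mono fun x hx ↦ hx.le)
  exact ⟨u ξ, ⟨⟨ξ, rfl⟩, Set.forall_mem_range.mpr hξ⟩, hpos ξ,
    two_mul_sq_le_H1 hv hvc hu0 hu2 hvu hξ, H2_le hv hvc hu0 hu2 hvu hξ⟩

open scoped Classical in
/-- The modulus `a + G / a^{2n-1}`, where `a` is the amplitude of the peakon of speed `c`
(and `1` if there is no such peakon). -/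
noncomputable def stabilityModulus (G : ℕ → ℝ → ℝ → ℝ) (n : ℕ) (c r : ℝ) : ℝ :=
  if 0 < Function.invFunOn (peakonSpeed n) (Set.Ioi 0) c then
    Function.invFunOn (peakonSpeed n) (Set.Ioi 0) c +
      G n c r / Function.invFunOn (peakonSpeed n) (Set.Ioi 0) c ^ (2 * n - 1)
  else 1

theorem stabilityModulus_pos {G : ℕ → ℝ → ℝ → ℝ} (hG : ∀ n c r, 0 < G n c r) (n : ℕ) (c r : ℝ) :
    0 < stabilityModulus G n c r := by
  rw [stabilityModulus]
  split_ifs with h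
  · have := hG n c r
    positivity
  · exact one_pos

theorem stabilityModulus_peakonSpeed (G : ℕ → ℝ → ℝ → ℝ) {n : ℕ} (hn : 1 ≤ n) {a : ℝ} (ha : 0 < a)
    (r : ℝ) : stabilityModulus G n (peakonSpeed n a) r =
      a + G n (peakonSpeed n a) r / a ^ (2 * n - 1) := by
  have h : Function.invFunOn (peakonSpeed n) (Set.Ioi 0) (peakonSpeed n a) = a :=
    (peakonSpeed_injOn hn).leftInvOn_invFunOn ha
  rw [stabilityModulus, h, if_pos ha]

end GeneralizedCH

theorem proposition1p5 (s : ℝ) (hs : 5 / 2 < s)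
    (G : ℕ → ℝ → ℝ → ℝ) (hG : ∀ n c r, 0 < G n c r) :
    ∃ G' : ℕ → ℝ → ℝ → ℝ, (∀ n c r, 0 < G' n c r) ∧
      ∀ n : ℕ, 1 ≤ n → ∀ γ : ℝ, 2 * √2 < γ → ∀ C₀ : ℝ, 0 < C₀ →
        ∃ C : ℝ, 0 < C ∧
          ∀ a : ℝ, 0 < a → ∀ c : ℝ, c = GeneralizedCH.peakonSpeed n a →
          ∀ u : ℝ → ℝ, Continuous u → GeneralizedCH.MemHs s u →
            (∀ x, 0 < u x) → (∀ x, 0 ≤ GeneralizedCH.momentum u x) →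
          ∀ ε : ℝ, 0 < ε →
            |GeneralizedCH.H1 u - GeneralizedCH.H1 (GeneralizedCH.peakon a)| ≤ a * γ * ε →
            |GeneralizedCH.H2 n u - GeneralizedCH.H2 n (GeneralizedCH.peakon a)| ≤
              C₀ * G n c (GeneralizedCH.hsNorm s u) * ε →
            ∃ M : ℝ, IsGreatest (Set.range u) M ∧
              |M - a| ≤ C * √(G' n c (GeneralizedCH.hsNorm s u) * ε) := by
  refine ⟨GeneralizedCH.stabilityModulus G, GeneralizedCH.stabilityModulus_pos hG, ?_⟩
  intro n hn γ hγ C₀ hC₀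
  obtain ⟨m, rfl⟩ := Nat.exists_eq_add_of_le' hn
  have hγ0 : 0 < γ := lt_trans (by positivity) hγ
  set S := GeneralizedCH.density (m + 1) 1 1 with hSdef
  have hS : 0 < S := zero_lt_two.trans_le (GeneralizedCH.two_le_density_one_one m)
  -- For `ε ≤ a`, `K₁` comes from the error in `H₂` and `K₂` from the error in `H₁` with `M ≤ (1 +
  -- γ) a`; `K₃` serves `ε ≥ a`.
  set K₁ : ℝ := (2 * m + 3) / (2 * S) * C₀ with hK₁
  set K₂ : ℝ := (2 * m + 3) / 4 * (1 + γ) ^ (2 * m + 1) * γ with hK₂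
  set K₃ : ℝ := 2 + γ / 2 with hK₃
  have hK₁0 : 0 < K₁ := by positivity
  have hK₂0 : 0 < K₂ := by positivity
  have hK₃0 : 0 < K₃ := by positivity
  refine ⟨√(K₁ + K₂ + K₃), by positivity, ?_⟩
  rintro a ha c rfl u hc hu hpos hmom ε hε hH1 hH2
  obtain ⟨M, hM, hM0, hMH1, hMH2⟩ := GeneralizedCH.exists_isGreatest_and_le hs hc hu hpos hmom
  refine ⟨M, hM, ?_⟩
  have hexp : 2 * (m + 1) - 1 = 2 * m + 1 := by omega
  rw [GeneralizedCH.stabilityModulus_peakonSpeed G hn ha, hexp, ← Real.sqrt_mul (by positivity)]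
  set g := G (m + 1) (GeneralizedCH.peakonSpeed (m + 1) a) (GeneralizedCH.hsNorm s u)
  have hg : 0 < g := hG _ _ _
  apply Real.abs_le_sqrt
  rw [GeneralizedCH.H1_peakon] at hH1
  rw [GeneralizedCH.H2_peakon, ← hSdef] at hH2
  have hE1 : GeneralizedCH.H1 u ≤ 2 * a ^ 2 + a * γ * ε := by linarith [(abs_le.mp hH1).2]
  have hq : 0 < g / a ^ (2 * m + 1) := by positivity
  rcases le_total ε a with hεa | hεa
  · have hE2 : 2 * S * a ^ (2 * m + 3) / (2 * m + 3) ≤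
        GeneralizedCH.H2 (m + 1) u + C₀ * g * ε := by
      have h := (abs_le.mp hH2).1
      have e : 2 * S * a ^ (2 * (m + 1) + 1) / (2 * ((m + 1 : ℕ) : ℝ) + 1) =
          2 * S * a ^ (2 * m + 3) / (2 * m + 3) := by
        push_cast
        congr 1
        ring
      rw [e] at h
      linarith
    have hMa : M ≤ (1 + γ) * a := by
      refine le_of_sq_le_sq ?_ (by positivity)
      have h1 : a * γ * ε ≤ a * γ * a := by gcongr
      nlinarith [mul_pos hγ0 (mul_pos ha ha), mul_pos (mul_pos hγ0 hγ0) (mul_pos ha ha)]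
    have hratio : M ^ (2 * m + 1) / a ^ (2 * m + 1) ≤ (1 + γ) ^ (2 * m + 1) := by
      rw [div_le_iff₀ (by positivity), ← mul_pow]
      exact pow_le_pow_left₀ hM0.le hMa _
    have key := GeneralizedCH.sub_sq_le ha hM0.le hS (hMH2 m) hE1 hE2
    calc (M - a) ^ 2 ≤ _ := key
      _ ≤ (2 * m + 3) / (2 * S) * (C₀ * g * ε / a ^ (2 * m + 1)) +
          (2 * m + 3) / 4 * (1 + γ) ^ (2 * m + 1) * (a * γ * ε) := by gcongr
      _ = K₁ * (g / a ^ (2 * m + 1)) * ε + K₂ * a * ε := by rw [hK₁, hK₂]; ring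
      _ ≤ (K₁ + K₂ + K₃) * (g / a ^ (2 * m + 1)) * ε + (K₁ + K₂ + K₃) * a * ε := by
        gcongr <;> linarith
      _ = _ := by ring
  -- Here `(M - a)² ≤ M² + a² ≤ 2a² + aγε/2`, and `a² ≤ aε`.
  · have h1 : a * a ≤ a * ε := by gcongr
    calc (M - a) ^ 2 ≤ K₃ * a * ε := by rw [hK₃]; nlinarith [mul_pos hM0 ha]
      _ ≤ (K₁ + K₂ + K₃) * (a + g / a ^ (2 * m + 1)) * ε := by gcongr <;> linarith
      _ = _ := by ring
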